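/- A planar doodle diagram is a finite connected 4-valent graph $D$ with at least one vertex (loops and parallel edges allowed) embedded in the sphere $S^2$; its vertices are called crossings, and the components of $S^2\setminus D$, which are open 2-cells, are called regions. It is minimal if every region has at least three sides (no monogons or bigons). A graph is $k$-connected if it has more than $k$ vertices and is not disconnected by the removal of fewer than $k$ vertices. A doodle is identified with its minimal diagram, and is called prime if this diagram is 3-connected. The dual graph $\Gamma$ of $D$ has one vertex for each region of $D$ and one edge for each edge of $D$, the edge dual to $e$ joining the (vertices corresponding to the) regions on the two sides of $e$. It divides the sphere into four-sided cells, one for each crossing $c$; the vertices and edges of that cell are the regions at $c$ and the duals of the edges at $c$. If a region $R$ is chosen as the infinite region, with corresponding vertex $v_\infty$ of $\Gamma$, the boundary of $\Gamma$ relative to $v_\infty$ is the link of $v_\infty$: the subgraph of $\Gamma$ consisting of all vertices and edges that lie in a cell containing $v_\infty$, other than $v_\infty$ itself and the edges ending at $v_\infty$. **Lemma.** Let $D$ be a minimal planar doodle diagram that is 2-connected. Then $D$ is prime if and only if, for every choice of infinite region $R$ of $D$, the boundary of the dual graph $\Gamma$ relative to $v_\infty$ is an embedded circle (that is, a cycle: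 its vertices and edges can be listed without repetition in a cyclic order $x_0,y_0,x_1,y_1,\dots,x_{m-1},y_{m-1}$, $m\ge 1$, with $y_i$ joining $x_i$ to $x_{i+1}$, indices modulo $m$). -/

import Mathlib

/-- A finite graph (loops and parallel edges allowed) cellularly embedded in a closed oriented
surface, given by its rotation system. The elements of `δ` are the darts (edges with a direction),
`rot` sends a dart to the next one counterclockwise around its initial vertex, and `rev` reverses
the direction of a dart. -/
structure SurfaceMap (δ : Type*) where
  rot : Equiv.Perm δ
  rev : Equiv.Perm δ
  rev_rev : ∀ d, rev (rev d) = d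
  rev_ne : ∀ d, rev d ≠ d

namespace SurfaceMap

variable {δ : Type*} (M : SurfaceMap δ)

/-- Walking along `d` with a region on the left-hand side, `M.next d` is the next dart of the
boundary of that region. -/
def next : Equiv.Perm δ := M.rot⁻¹ * M.rev

/-- Vertices (crossings) are the orbits of `rot`. -/
def Crossing : Type _ := Quotient (Equiv.Perm.SameCycle.setoid M.rot)

/-- Edges are the orbits `{d, rev d}` of `rev`. -/
def Edge : Type _ := Quotient (Equiv.Perm.SameCycle.setoid M.rev)

/-- Regions are the orbits of `next`: the closed walks around the complementary 2-cells. -/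
def Region : Type _ := Quotient (Equiv.Perm.SameCycle.setoid M.next)

/-- The crossing from which the dart `d` starts. -/
def source (d : δ) : M.Crossing := Quotient.mk _ d

/-- The undirected edge underlying the dart `d`. -/
def edge (d : δ) : M.Edge := Quotient.mk _ d

/-- The region to the left of the dart `d`; it contains the corner at `M.source d` between `d`
and `M.rot d`. -/
def left (d : δ) : M.Region := Quotient.mk _ d

/-- Adjacency of distinct crossings. Loops and parallel edges play no role in connectivity. -/
def graph : SimpleGraph M.Crossing where
  Adj u v := u ≠ v ∧ ∃ d, M.source d = u ∧ M.source (M.rev d) = v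
  symm := ⟨by
    rintro u v ⟨h, d, hu, hv⟩
    exact ⟨h.symm, M.rev d, hv, by rw [M.rev_rev]; exact hu⟩⟩
  loopless := ⟨fun _ h => h.1 rfl⟩

/-- The crossing `c` lies on the boundary of the region `R`. -/
def OnRegion (c : M.Crossing) (R : M.Region) : Prop :=
  ∃ d, M.source d = c ∧ M.left d = R

/-- The crossing `c` is an end of the edge `e`. -/
def OnEdge (c : M.Crossing) (e : M.Edge) : Prop :=
  ∃ d, M.source d = c ∧ M.edge d = e

/-- The number of sides of a region: `R` is an `M.sides R`-gon. -/
noncomputable def sides (R : M.Region) : ℕ := {d | M.left d = R}.ncard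

theorem edge_eq_iff (d d' : δ) : M.edge d = M.edge d' ↔ d' = d ∨ d' = M.rev d := by
  have hinv : M.rev⁻¹ = M.rev := by
    ext d
    rw [Equiv.Perm.inv_eq_iff_eq, M.rev_rev]
  have h2 : M.rev * M.rev = 1 := by
    ext d
    exact M.rev_rev d
  constructor
  · intro h
    obtain ⟨i, hi⟩ : M.rev.SameCycle d d' := Quotient.exact h
    rcases Int.even_or_odd' i with ⟨k, rfl | rfl⟩
    · left
      rw [zpow_mul, zpow_two, h2, one_zpow] at hi
      exact hi.symm
    · right
      rw [zpow_add, zpow_mul, zpow_two, h2, one_zpow, one_mul, zpow_one] at hi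
      exact hi.symm
  · rintro (rfl | rfl)
    · rfl
    · exact Quotient.sound ⟨1, by simp⟩

/-- The dual graph: one vertex for each region, one edge for each edge; the edge dual to `e` joins
the regions on the two sides of `e`. Its 2-cells correspond to the crossings. -/
def dual : Graph M.Region M.Edge where
  vertexSet := Set.univ
  IsLink e R S := ∃ d, M.edge d = e ∧ M.left d = R ∧ M.left (M.rev d) = S
  isLink_symm := by
    intro e _
    refine ⟨?_⟩
    rintro R S ⟨d, he, hR, hS⟩
    refine ⟨M.rev d, ?_, hS, by rw [M.rev_rev]; exact hR⟩
    rw [← he, M.edge_eq_iff]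
    exact Or.inr (M.rev_rev d).symm
  eq_or_eq_of_isLink_of_isLink := by
    rintro e R S T U ⟨d, he, hR, hS⟩ ⟨d', he', hT, hU⟩
    rcases (M.edge_eq_iff d d').1 (he.trans he'.symm) with rfl | rfl
    · exact Or.inl (hR.symm.trans hT)
    · rw [M.rev_rev] at hU
      exact Or.inr (hR.symm.trans hU)
  left_mem_of_isLink := fun _ _ _ _ => Set.mem_univ _

theorem left_next (d : δ) : M.left (M.next d) = M.left d :=
  (Quotient.sound (⟨1, by simp⟩ : M.next.SameCycle d (M.next d))).symm

theorem source_next (d : δ) : M.source (M.next d) = M.source (M.rev d) :=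
  Quotient.sound (⟨1, by simp [next]⟩ : M.rot.SameCycle (M.next d) (M.rev d))

/-- The boundary of the dual graph relative to the vertex `R` ("infinite vertex"), that is, the
link of `R`. The 2-cell of the dual graph corresponding to a crossing `c` has as its vertices the
regions at `c` and as its edges the duals of the edges at `c`. The link consists of all vertices
and edges that lie in a common 2-cell with `R`, other than `R` itself and the edges ending
in `R`. -/
def boundary (R : M.Region) : Graph M.Region M.Edge where
  vertexSet := {S | S ≠ R ∧ ∃ c, M.OnRegion c R ∧ M.OnRegion c S}
  IsLink e S T :=
    M.dual.IsLink e S T ∧ ¬ M.dual.Inc e R ∧ ∃ c, M.OnRegion c R ∧ M.OnEdge c e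
  isLink_symm := fun _ _ => ⟨fun _ _ h => ⟨h.1.symm, h.2⟩⟩
  eq_or_eq_of_isLink_of_isLink := fun _ _ _ _ _ h h' =>
    M.dual.eq_or_eq_of_isLink_of_isLink h.1 h'.1
  left_mem_of_isLink := by
    rintro e S T ⟨h, hR, c, hc, d', hd', he'⟩
    refine ⟨fun hS => hR ⟨T, hS ▸ h⟩, c, hc, ?_⟩
    obtain ⟨d, he, hS, -⟩ := h
    rcases (M.edge_eq_iff d d').1 (he.trans he'.symm) with rfl | rfl
    · exact ⟨_, hd', hS⟩
    · exact ⟨M.next d, (M.source_next d).trans hd', (M.left_next d).trans hS⟩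

end SurfaceMap

/-- A (nontrivial, irreducible, unoriented) planar doodle diagram: a connected 4-valent graph in
the sphere. For a connected graph, the surface is the sphere exactly when Euler's formula
`V - E + F = 2` holds. -/
structure DoodleDiagram (δ : Type*) [Finite δ] extends SurfaceMap δ where
  four_valent : ∀ c : toSurfaceMap.Crossing, {d | toSurfaceMap.source d = c}.ncard = 4
  connected : toSurfaceMap.graph.Connected
  euler : Nat.card toSurfaceMap.Crossing + Nat.card toSurfaceMap.Region =
    Nat.card toSurfaceMap.Edge + 2

/-- A graph is `k`-connected if it has more than `k` vertices and is not disconnected by the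
removal of fewer than `k` vertices. -/
def IsKConnected {V : Type*} (k : ℕ) (G : SimpleGraph V) : Prop :=
  k < Nat.card V ∧ ∀ S : Finset V, S.card < k → (G.induce (↑S : Set V)ᶜ).Connected

namespace DoodleDiagram

variable {δ : Type*} [Finite δ] (D : DoodleDiagram δ)

/-- A diagram is minimal if it has no monogons and no bigons. -/
def IsMinimal : Prop := ∀ R : D.Region, 3 ≤ D.sides R

/-- A doodle is prime if it is 3-connected. -/
def IsPrime : Prop := IsKConnected 3 D.graph

end DoodleDiagram

/-- A multigraph is a circle if its vertices and edges can be arranged, without repetition, in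
cyclic order `x₀, y₀, x₁, y₁, …, xₙ₋₁, yₙ₋₁` with `n ≥ 1`, such that `yᵢ` joins `xᵢ` to `xᵢ₊₁`
(indices modulo `n`). -/
def IsCircle {α β : Type*} (G : Graph α β) : Prop :=
  ∃ n : ℕ, 0 < n ∧ ∃ (x : ZMod n → α) (y : ZMod n → β),
    Function.Injective x ∧ Function.Injective y ∧
    Set.range x = G.vertexSet ∧ Set.range y = G.edgeSet ∧
    ∀ i, G.IsLink (y i) (x i) (x (i + 1))

/-!
Over `ZMod 2`, the incidence vectors of the crossings and regions on the corners of a spherical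
diagram span a subspace whose orthogonal complement, by Euler's formula, consists exactly of the
coboundaries of edge functions. This is the Jordan curve theorem in the form needed here: a closed
curve passing alternately through crossings and regions two-colors the edges, and the color
changes precisely at the corners that the curve traverses.

Applied to curves through one or two crossings, it shows that a minimal diagram is 3-connected
exactly when no region meets itself at a crossing and two distinct regions meet at two crossings
only along an edge joining these crossings. If no region meets itself, the link of a region `R` is
traced by a closed walk visiting the other corners at the crossings of `R`, so it is a circle iff
the regions of these corners are distinct, and this is the second condition. If `R` meets itself at
a crossing, the curve through `R` and that crossing separates the link of `R`.
-/

open Equiv Module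
open scoped Matrix

section LinearAlgebra

variable {K V W ι : Type*} [Field K] [AddCommGroup V] [Module K V] [AddCommGroup W] [Module K W]

theorem finrank_le_finrank_range_add_one [FiniteDimensional K V] {T : V →ₗ[K] W} {v : V}
    (hT : LinearMap.ker T ≤ K ∙ v) : finrank K V ≤ finrank K (LinearMap.range T) + 1 := by
  rw [← T.finrank_range_add_finrank_ker]
  gcongr
  exact (Submodule.finrank_mono hT).trans (by simpa using finrank_span_le_card (R := K) {v})

theorem mem_of_dotProduct_eq_zero [Fintype ι] {L A : Submodule K (ι → K)}
    (hLA : ∀ l ∈ L, ∀ a ∈ A, l ⬝ᵥ a = 0) (hdim : Fintype.card ι ≤ finrank K L + finrank K A)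
    {k : ι → K} (hk : ∀ l ∈ L, l ⬝ᵥ k = 0) : k ∈ A := by
  classical
  let B : LinearMap.BilinForm K (ι → K) := dotProductBilin K K
  have hB : B.Nondegenerate :=
    ⟨fun v hv => dotProduct_eq_zero v hv,
      fun v hv => dotProduct_eq_zero v fun w => (dotProduct_comm v w).trans (hv w)⟩
  have hA : A = B.orthogonal L := by
    refine Submodule.eq_of_le_of_finrank_le (fun a ha l hl => hLA l hl a ha) ?_
    rw [LinearMap.BilinForm.finrank_orthogonal hB, finrank_fintype_fun_eq_card]
    lia
  rw [hA]
  exact hk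

end LinearAlgebra

theorem card_eq_sum_ncard_fiber {α β : Type*} [Finite α] [Fintype β] (f : α → β) :
    Nat.card α = ∑ b, {a | f a = b}.ncard := by
  rw [← Nat.card_congr (Equiv.sigmaFiberEquiv f), Nat.card_sigma]
  rfl

theorem ncard_pair_le {α : Type*} (a b : α) : ({a, b} : Set α).ncard ≤ 2 := by
  simpa using Set.ncard_insert_le a {b}

theorem sum_eq_zero_of_involution {α : Type*} [Fintype α] {σ : Perm α} (hσ : ∀ x, σ (σ x) = x)
    (hσ_ne : ∀ x, σ x ≠ x) {f : α → ZMod 2} (hf : ∀ x, f (σ x) = f x) : ∑ x, f x = 0 :=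
  Finset.sum_involution (fun x _ => σ x) (fun x _ => by rw [hf, CharTwo.add_self_eq_zero])
    (fun x _ _ => hσ_ne x) (fun _ _ => Finset.mem_univ _) (fun x _ => hσ x)

theorem eq_add_one_of_ne {a b : ZMod 2} (hab : a ≠ b) : a = b + 1 := by
  decide +revert

section Perm

variable {α X : Type*} {σ : Perm α}

theorem sameCycle_induction [Finite α] {p : α → Prop} (hp : ∀ x, p x → p (σ x)) {x y : α}
    (hxy : σ.SameCycle x y) (hx : p x) : p y := by
  obtain ⟨n, rfl⟩ := hxy.exists_nat_pow_eq
  induction n with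
  | zero => exact hx
  | succ n ih =>
    rw [pow_succ', Perm.mul_apply]
    exact hp _ (ih ⟨n, by simp⟩)

theorem exists_ne_sameCycle_apply_ne [Finite α] {f : α → X} {x : α} (hx : f (σ x) ≠ f x) :
    ∃ y ≠ x, σ.SameCycle x y ∧ f (σ y) ≠ f y := by
  by_contra! hconst
  have hcycle : σ.SameCycle (σ x) x := ⟨-1, by simp⟩
  refine hx (sameCycle_induction (p := fun y => σ.SameCycle x y ∧ f y = f (σ x)) ?_ hcycle
    ⟨hcycle.symm, rfl⟩).2.symm
  rintro y ⟨hxy, hy⟩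
  refine ⟨hxy.apply_right, ?_⟩
  by_cases hyx : y = x
  · rw [hyx]
  · rw [hconst y hyx hxy, hy]

theorem isCycleOn_sameCycle (σ : Perm α) (x : α) : σ.IsCycleOn {y | σ.SameCycle x y} :=
  ⟨⟨fun _ hy => Perm.SameCycle.apply_right hy, σ.injective.injOn,
    fun y hy => ⟨σ.symm y, Perm.SameCycle.symm_apply_right hy, by simp⟩⟩,
    fun _ hy _ hz => hy.symm.trans hz⟩

theorem exists_zmod_parametrization {s : Finset α} (hσ : σ.IsCycleOn s)
    (hs : s.Nonempty) :
    ∃ e : ZMod s.card → α, e.Injective ∧ Set.range e = s ∧ ∀ i, e (i + 1) = σ (e i) := by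
  obtain ⟨x, hx⟩ := hs
  refine ⟨fun i => (σ ^ (i.cast : ℤ)) x, fun i j hij => ?_, ?_, fun i => ?_⟩
  · simpa [← ZMod.intCast_eq_intCast_iff] using (hσ.zpow_apply_eq_zpow_apply hx).1 hij
  · refine Set.Subset.antisymm ?_ fun y hy => ?_
    · rintro _ ⟨i, rfl⟩
      exact (hσ.1.perm_zpow _).mapsTo hx
    · obtain ⟨m, rfl⟩ := hσ.2 hx hy
      refine ⟨m, (hσ.zpow_apply_eq_zpow_apply hx).2 ?_⟩
      simp [← ZMod.intCast_eq_intCast_iff]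
  · rw [← Perm.mul_apply, ← zpow_one_add, hσ.zpow_apply_eq_zpow_apply hx]
    simp [← ZMod.intCast_eq_intCast_iff, add_comm]

end Perm

section Circle

variable {α β X W : Type*} {G : Graph α β}

theorem IsCircle.apply_eq_of_isLink (hG : IsCircle G) {f : α → X}
    (hf : ∀ e S T, G.IsLink e S T → f S = f T) {S T : α} (hS : S ∈ G.vertexSet)
    (hT : T ∈ G.vertexSet) : f S = f T := by
  obtain ⟨n, hn, x, y, -, -, hxV, -, hxy⟩ := hG
  have : NeZero n := ⟨hn.ne'⟩
  have hconst (k : ℕ) : f (x k) = f (x 0) := by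
    induction k with
    | zero => rw [Nat.cast_zero]
    | succ k ih => rw [Nat.cast_succ, ← hf _ _ _ (hxy k), ih]
  rw [← hxV] at hS hT
  obtain ⟨i, rfl⟩ := hS
  obtain ⟨j, rfl⟩ := hT
  rw [← ZMod.natCast_zmod_val i, ← ZMod.natCast_zmod_val j, hconst, hconst]

theorem IsCircle.exists_cyclicCoordinate (hG : IsCircle G) :
    ∃ (n : ℕ) (y : ZMod n → β) (q : α → ZMod n), ∀ e S T, G.IsLink e S T →
      (e = y (q S) ∧ q T = q S + 1) ∨ (e = y (q T) ∧ q S = q T + 1) := by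
  obtain ⟨n, -, x, y, hx, -, -, hyE, hxy⟩ := hG
  have hq := Function.leftInverse_invFun hx
  refine ⟨n, y, Function.invFun x, fun e S T hST => ?_⟩
  obtain ⟨i, rfl⟩ : e ∈ Set.range y := hyE ▸ hST.edge_mem
  rcases (hxy i).eq_and_eq_or_eq_and_eq hST with ⟨rfl, rfl⟩ | ⟨rfl, rfl⟩
  · exact .inl ⟨by rw [hq], by rw [hq, hq]⟩
  · exact .inr ⟨by rw [hq], by rw [hq, hq]⟩

variable {σ : Perm W} {s : Set W} {a : W → α} {b : W → β}

theorem isCircle_of_injOn [Finite W] (hσ : σ.IsCycleOn s) (hs : s.Nonempty)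
    (hlink : ∀ w ∈ s, G.IsLink (b w) (a w) (a (σ w))) (hσσ : ∀ w ∈ s, σ (σ w) ≠ w)
    (ha : s.InjOn a) (hV : G.vertexSet ⊆ a '' s) (hE : G.edgeSet ⊆ b '' s) : IsCircle G := by
  obtain ⟨t, rfl⟩ := s.toFinite.exists_finset_coe
  obtain ⟨e, he, he_range, he_succ⟩ := exists_zmod_parametrization hσ hs
  have he_mem (i) : e i ∈ (t : Set W) := he_range ▸ Set.mem_range_self i
  have hb : Set.InjOn b t := fun w hw w' hw' hww' => by
    rcases (hlink w hw).eq_and_eq_or_eq_and_eq (hww' ▸ hlink w' hw') with ⟨h, -⟩ | ⟨h, h'⟩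
    · exact ha hw hw' h
    · have hw_eq : w = σ w' := ha hw (hσ.1.mapsTo hw') h
      have hw'_eq : σ w = w' := ha (hσ.1.mapsTo hw) hw' h'
      exact absurd (by rw [hw'_eq, ← hw_eq]) (hσσ w hw)
  refine ⟨t.card, Finset.card_pos.2 hs, a ∘ e, b ∘ e,
    fun i j hij => he (ha (he_mem i) (he_mem j) hij),
    fun i j hij => he (hb (he_mem i) (he_mem j) hij), ?_, ?_, fun i => ?_⟩
  · rw [Set.range_comp, he_range]
    refine Set.Subset.antisymm ?_ hV
    rintro _ ⟨w, hw, rfl⟩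
    exact (hlink w hw).left_mem
  · rw [Set.range_comp, he_range]
    refine Set.Subset.antisymm ?_ hE
    rintro _ ⟨w, hw, rfl⟩
    exact (hlink w hw).edge_mem
  · simpa [he_succ] using hlink _ (he_mem i)

theorem IsCircle.injOn_of_walk [Finite W] (hG : IsCircle G) (hσ : σ.IsCycleOn s)
    (hlink : ∀ w ∈ s, G.IsLink (b w) (a w) (a (σ w))) (hback : ∀ w ∈ s, b (σ w) ≠ b w)
    (hab : ∀ w ∈ s, ∀ w' ∈ s, a w = a w' → b w = b w' → w = w') : s.InjOn a := by
  -- Without backtracking the walk keeps its direction around the circle, so the edge by which it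
  -- leaves a vertex depends only on that vertex.
  obtain ⟨n, y, q, hq⟩ := hG.exists_cyclicCoordinate
  have hmaps {w} (hw : w ∈ s) : σ w ∈ s := hσ.1.mapsTo hw
  have hforward {w w'} (hw : w ∈ s) (hw' : w' ∈ s)
      (h : b w = y (q (a w)) ∧ q (a (σ w)) = q (a w) + 1) : b w' = y (q (a w')) := by
    refine (sameCycle_induction (σ := σ)
      (p := fun w => w ∈ s ∧ b w = y (q (a w)) ∧ q (a (σ w)) = q (a w) + 1) ?_
      (hσ.2 hw hw') ⟨hw, h⟩).2.1
    rintro z ⟨hz, hz_b, hz_q⟩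
    refine ⟨hmaps hz, (hq _ _ _ (hlink _ (hmaps hz))).resolve_right fun ⟨hb, hq'⟩ =>
      hback z hz ?_⟩
    rw [hb, hz_b, add_right_cancel (hq'.symm.trans hz_q)]
  intro w hw w' hw' hww'
  refine hab w hw w' hw' hww' ?_
  rcases hq _ _ _ (hlink w hw) with h | h
  · rw [h.1, hforward hw hw' h, hww']
  · rcases hq _ _ _ (hlink w' hw') with h' | h'
    · rw [h'.1, hforward hw' hw h', hww']
    · rw [h.1, h'.1, add_right_cancel (h.2.symm.trans (hww' ▸ h'.2))]

end Circle

section Separation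

variable {V : Type*} {G : SimpleGraph V} {S A B : Set V}

/-- `A` and `B` are the two sides of a separation of `G` by `S`: they are nonempty, partition the
complement of `S`, and are joined by no edge. -/
structure IsSeparation (G : SimpleGraph V) (S A B : Set V) : Prop where
  left_nonempty : A.Nonempty
  right_nonempty : B.Nonempty
  disjoint : Disjoint A B
  union_eq : A ∪ B = Sᶜ
  not_adj : ∀ a ∈ A, ∀ b ∈ B, ¬ G.Adj a b

theorem IsSeparation.symm (h : IsSeparation G S A B) : IsSeparation G S B A :=
  ⟨h.right_nonempty, h.left_nonempty, h.disjoint.symm, Set.union_comm B A ▸ h.union_eq,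
    fun b hb a ha hba => h.not_adj a ha b hb hba.symm⟩

theorem IsSeparation.notMem_of_mem_left (h : IsSeparation G S A B) {a : V} (ha : a ∈ A) : a ∉ S :=
  h.union_eq.subset (.inl ha)

theorem exists_isSeparation (hS : ¬ (G.induce Sᶜ).Preconnected) :
    ∃ A B, IsSeparation G S A B := by
  simp only [SimpleGraph.Preconnected, not_forall] at hS
  obtain ⟨a, b, hab⟩ := hS
  refine ⟨(↑) '' {v | (G.induce Sᶜ).Reachable a v}, (↑) '' {v | ¬ (G.induce Sᶜ).Reachable a v},
    ⟨a, a, .rfl, rfl⟩, ⟨b, b, hab, rfl⟩, ?_, ?_, ?_⟩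
  · rw [Set.disjoint_image_iff Subtype.val_injective]
    exact disjoint_compl_right
  · rw [← Set.image_union]
    exact (congrArg _ (Set.union_compl_self _)).trans (Subtype.coe_image_univ Sᶜ)
  · rintro _ ⟨v, hv, rfl⟩ _ ⟨w, hw, rfl⟩ hvw
    exact hw (hv.trans (SimpleGraph.Adj.reachable (G := G.induce Sᶜ) hvw))

end Separation

namespace SurfaceMap

variable {δ : Type*} (M : SurfaceMap δ)

theorem source_eq_iff {x y : δ} : M.source x = M.source y ↔ M.rot.SameCycle x y := Quotient.eq

theorem left_eq_iff {x y : δ} : M.left x = M.left y ↔ M.next.SameCycle x y := Quotient.eq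

theorem source_surjective : M.source.Surjective := Quotient.mk_surjective

theorem edge_surjective : M.edge.Surjective := Quotient.mk_surjective

theorem left_surjective : M.left.Surjective := Quotient.mk_surjective

instance [Finite δ] : Finite M.Crossing := .of_surjective _ M.source_surjective

instance [Finite δ] : Finite M.Edge := .of_surjective _ M.edge_surjective

instance [Finite δ] : Finite M.Region := .of_surjective _ M.left_surjective

@[simp]
theorem source_rot (x : δ) : M.source (M.rot x) = M.source x := M.source_eq_iff.2 ⟨-1, by simp⟩

@[simp]
theorem source_rot_symm (x : δ) : M.source (M.rot.symm x) = M.source x := by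
  simpa using (M.source_rot (M.rot.symm x)).symm

@[simp]
theorem edge_rev (x : δ) : M.edge (M.rev x) = M.edge x :=
  (M.edge_eq_iff _ _).2 (.inr (M.rev_rev x).symm)

@[simp]
theorem rot_next (x : δ) : M.rot (M.next x) = M.rev x := by simp [next]

@[simp]
theorem next_rev_rot (x : δ) : M.next (M.rev (M.rot x)) = x := by simp [next, M.rev_rev]

@[simp]
theorem left_rev_rot (x : δ) : M.left (M.rev (M.rot x)) = M.left x := by
  rw [← M.left_next, M.next_rev_rot]

theorem left_rot_symm (x : δ) : M.left (M.rot.symm x) = M.left (M.rev x) := by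
  simpa using (M.left_rev_rot (M.rot.symm x)).symm

theorem isCycleOn_rot (x : δ) : M.rot.IsCycleOn {y | M.source x = M.source y} := by
  simpa only [source_eq_iff] using isCycleOn_sameCycle M.rot x

section Counting

variable [Finite δ]

theorem card_darts : Nat.card δ = 2 * Nat.card M.Edge := by
  have hpair (e : M.Edge) : {x | M.edge x = e}.ncard = 2 := by
    obtain ⟨x, rfl⟩ := M.edge_surjective e
    have : {y | M.edge y = M.edge x} = {x, M.rev x} := by
      ext y
      rw [Set.mem_ofPred_eq, eq_comm, M.edge_eq_iff]
      simp
    rw [this, Set.ncard_pair (M.rev_ne x).symm]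
  have := Fintype.ofFinite M.Edge
  rw [card_eq_sum_ncard_fiber M.edge]
  simp [hpair, mul_comm]

variable {M} (hsides : ∀ R, 3 ≤ M.sides R)
include hsides

theorem three_mul_card_region_le : 3 * Nat.card M.Region ≤ Nat.card δ := by
  have := Fintype.ofFinite M.Region
  rw [card_eq_sum_ncard_fiber M.left]
  calc 3 * Nat.card M.Region
    _ = ∑ _ : M.Region, 3 := by simp [mul_comm]
    _ ≤ ∑ R, M.sides R := Finset.sum_le_sum fun R _ => hsides R

theorem next_next_ne_self (x : δ) : M.next (M.next x) ≠ x := by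
  classical
  intro hx
  have hsub : {y | M.left y = M.left x} ⊆ {x, M.next x} := fun y hy =>
    sameCycle_induction (p := (· ∈ ({x, M.next x} : Set δ)))
      (by rintro _ (rfl | rfl) <;> simp [hx]) (M.left_eq_iff.1 (Eq.symm hy)) (by simp)
  have hsides_le : M.sides (M.left x) ≤ 2 := (Set.ncard_le_ncard hsub).trans (ncard_pair_le _ _)
  exact absurd (hsides (M.left x)) (by lia)

theorem next_ne_self (x : δ) : M.next x ≠ x := fun hx =>
  next_next_ne_self hsides x (by rw [hx, hx])

theorem rev_ne_rot (x : δ) : M.rev x ≠ M.rot x := fun hx =>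
  next_ne_self hsides x (M.rot.injective (by rw [rot_next, hx]))

end Counting

section Coloring

theorem color_eq_of_preconnected {X : Type*} [Finite δ] {S : Set M.Crossing}
    (hS : (M.graph.induce S).Preconnected) {h : δ → X} (hrev : ∀ x, h (M.rev x) = h x)
    (hrot : ∀ x, M.source x ∈ S → h (M.rot x) = h x) {x y : δ} (hx : M.source x ∈ S)
    (hy : M.source y ∈ S) : h x = h y := by
  have hsource {x y : δ} (hx : M.source x ∈ S) (hxy : M.source x = M.source y) : h x = h y :=
    (sameCycle_induction (p := fun y => M.source y ∈ S ∧ h x = h y)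
      (fun y hy => ⟨by simpa using hy.1, by rw [hrot y hy.1, hy.2]⟩)
      (M.source_eq_iff.1 hxy) ⟨hx, rfl⟩).2
  suffices ∀ v : S, ∀ y, M.source y = v → h x = h y from this ⟨_, hy⟩ y rfl
  intro v
  induction (SimpleGraph.reachable_iff_reflTransGen _ _).1 (hS ⟨_, hx⟩ v) with
  | refl => exact fun y hy => hsource hx hy.symm
  | @tail v w _ hvw ih =>
    intro y hy
    obtain ⟨-, d, hd, hd'⟩ := hvw
    rw [ih d hd, ← hrev d]
    exact hsource (hd' ▸ w.2) (hd'.trans hy.symm)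

theorem color_eq_of_connected {X : Type*} [Finite δ] (hc : M.graph.Connected) {h : δ → X}
    (hrev : ∀ x, h (M.rev x) = h x) (hrot : ∀ x, h (M.rot x) = h x) (x y : δ) : h x = h y :=
  M.color_eq_of_preconnected
    ((SimpleGraph.induceUnivIso M.graph).connected_iff.2 hc).preconnected hrev
    (fun x _ => hrot x) (Set.mem_univ _) (Set.mem_univ _)

/-- The mod 2 coboundary of a function on the edges, read off at the corners: at the corner between
`x` and `M.rot x` it compares the values on the two edges bounding the corner. -/
def edgeCoboundary : (M.Edge → ZMod 2) →ₗ[ZMod 2] δ → ZMod 2 where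
  toFun h x := h (M.edge x) + h (M.edge (M.rot x))
  map_add' h h' := by ext x; simp only [Pi.add_apply]; ring
  map_smul' a h := by ext x; simp [mul_add]

/-- The corner between `x` and `M.rot x` lies at the crossing `M.source x` in the region `M.left x`;
a function on crossings and regions is sent to the sum of its two values there. This is the
coboundary of the graph on crossings and regions whose edges are the corners. -/
def cornerSum : (M.Crossing → ZMod 2) × (M.Region → ZMod 2) →ₗ[ZMod 2] δ → ZMod 2 where
  toFun f x := f.1 (M.source x) + f.2 (M.left x)
  map_add' f f' := by ext x; simp only [Prod.fst_add, Prod.snd_add, Pi.add_apply]; ring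
  map_smul' a f := by ext x; simp [mul_add]

theorem cornerSum_dotProduct_edgeCoboundary [Fintype δ] (f) (h : M.Edge → ZMod 2) :
    M.cornerSum f ⬝ᵥ M.edgeCoboundary h = 0 := by
  obtain ⟨f, g⟩ := f
  set k := h ∘ M.edge
  have hk (x) : k (M.rev x) = k x := congrArg h (M.edge_rev x)
  have hf : ∑ x, f (M.source x) * k (M.rot x) = ∑ x, f (M.source x) * k x := by
    simpa using Equiv.sum_comp M.rot fun x => f (M.source x) * k x
  have hg : ∑ x, g (M.left x) * k (M.rot x) = ∑ x, g (M.left x) * k x :=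
    calc ∑ x, g (M.left x) * k (M.rot x)
      _ = ∑ x, g (M.left (M.rev x)) * k (M.rev x) := by
        simpa [hk] using Equiv.sum_comp M.rot fun x => g (M.left (M.rev x)) * k x
      _ = ∑ x, g (M.left x) * k x := Equiv.sum_comp M.rev fun x => g (M.left x) * k x
  calc M.cornerSum (f, g) ⬝ᵥ M.edgeCoboundary h
    _ = ∑ x, (f (M.source x) * k x + f (M.source x) * k (M.rot x)) +
        ∑ x, (g (M.left x) * k x + g (M.left x) * k (M.rot x)) := by
      rw [← Finset.sum_add_distrib]
      refine Finset.sum_congr rfl fun x _ => ?_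
      simp only [cornerSum, edgeCoboundary, LinearMap.coe_mk, AddHom.coe_mk, k, Function.comp]
      ring
    _ = 0 := by simp only [Finset.sum_add_distrib, hf, hg, CharTwo.add_self_eq_zero]

variable {M} [Finite δ] (hc : M.graph.Connected)
include hc

theorem card_edge_le_finrank_range_edgeCoboundary :
    Nat.card M.Edge ≤ finrank (ZMod 2) (LinearMap.range M.edgeCoboundary) + 1 := by
  have := Fintype.ofFinite M.Edge
  rw [Nat.card_eq_fintype_card, ← finrank_fintype_fun_eq_card (ZMod 2)]
  refine finrank_le_finrank_range_add_one (v := 1) fun h hh => ?_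
  have hrot (x) : h (M.edge (M.rot x)) = h (M.edge x) :=
    (CharTwo.add_eq_zero.1 (congrFun hh x)).symm
  obtain ⟨x⟩ : Nonempty δ := hc.nonempty.map Quotient.out
  refine Submodule.mem_span_singleton.2 ⟨h (M.edge x), funext fun e => ?_⟩
  obtain ⟨y, rfl⟩ := M.edge_surjective e
  simpa using M.color_eq_of_connected hc (h := h ∘ M.edge) (fun x => by simp) hrot x y

theorem card_crossing_add_card_region_le_finrank_range_cornerSum :
    Nat.card M.Crossing + Nat.card M.Region ≤
      finrank (ZMod 2) (LinearMap.range M.cornerSum) + 1 := by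
  have := Fintype.ofFinite M.Crossing
  have := Fintype.ofFinite M.Region
  rw [Nat.card_eq_fintype_card, Nat.card_eq_fintype_card,
    ← finrank_fintype_fun_eq_card (ZMod 2) (η := M.Crossing),
    ← finrank_fintype_fun_eq_card (ZMod 2) (η := M.Region), ← finrank_prod]
  refine finrank_le_finrank_range_add_one (v := 1) fun ⟨f, g⟩ hfg => ?_
  have hfg (x) : f (M.source x) = g (M.left x) := CharTwo.add_eq_zero.1 (congrFun hfg x)
  have hrev (x) : f (M.source (M.rev x)) = f (M.source x) := by
    rw [← source_next, hfg, left_next, ← hfg]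
  obtain ⟨x⟩ : Nonempty δ := hc.nonempty.map Quotient.out
  have hf (y) : f (M.source x) = f (M.source y) :=
    M.color_eq_of_connected hc (h := f ∘ M.source) hrev (fun x => by simp) x y
  refine Submodule.mem_span_singleton.2 ⟨f (M.source x), Prod.ext (funext fun c => ?_)
    (funext fun R => ?_)⟩
  · obtain ⟨y, rfl⟩ := M.source_surjective c
    simpa using hf y
  · obtain ⟨y, rfl⟩ := M.left_surjective R
    simpa [← hfg] using hf y

theorem exists_coloring_of_corners
    (heuler : Nat.card M.Crossing + Nat.card M.Region = Nat.card M.Edge + 2) {C : Finset δ}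
    (hcrossing : ∀ f : M.Crossing → ZMod 2, ∑ x ∈ C, f (M.source x) = 0)
    (hregion : ∀ g : M.Region → ZMod 2, ∑ x ∈ C, g (M.left x) = 0) :
    ∃ h : δ → ZMod 2, (∀ x, h (M.rev x) = h x) ∧ ∀ x, h (M.rot x) ≠ h x ↔ x ∈ C := by
  classical
  have := Fintype.ofFinite δ
  have hC : (fun x => if x ∈ C then 1 else 0) ∈ LinearMap.range M.edgeCoboundary := by
    refine mem_of_dotProduct_eq_zero (L := LinearMap.range M.cornerSum) ?_ ?_ ?_
    · rintro _ ⟨f, rfl⟩ _ ⟨h, rfl⟩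
      exact M.cornerSum_dotProduct_edgeCoboundary f h
    · have := card_edge_le_finrank_range_edgeCoboundary hc
      have := card_crossing_add_card_region_le_finrank_range_cornerSum hc
      have := M.card_darts
      rw [← Nat.card_eq_fintype_card]
      lia
    · rintro _ ⟨⟨f, g⟩, rfl⟩
      simpa [dotProduct, cornerSum, Finset.sum_add_distrib, hregion] using hcrossing f
  obtain ⟨h, hh⟩ := hC
  refine ⟨h ∘ M.edge, fun x => by simp, fun x => ?_⟩
  have hx : h (M.edge x) + h (M.edge (M.rot x)) = if x ∈ C then 1 else 0 := congrFun hh x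
  rw [← not_iff_not, not_ne_iff, eq_comm, ← CharTwo.add_eq_zero]
  simp [hx]

end Coloring

section ColorChange

variable {M} {X : Type*} [Finite δ] {h : δ → X}

theorem exists_ne_source_eq_color_ne {x : δ} (hx : h (M.rot x) ≠ h x) :
    ∃ y ≠ x, M.source x = M.source y ∧ h (M.rot y) ≠ h y := by
  simpa only [source_eq_iff] using exists_ne_sameCycle_apply_ne hx

theorem exists_ne_left_eq_color_ne (hrev : ∀ x, h (M.rev x) = h x) {x : δ}
    (hx : h (M.rot x) ≠ h x) : ∃ y ≠ x, M.left x = M.left y ∧ h (M.rot y) ≠ h y := by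
  obtain ⟨z, rfl⟩ := M.next.surjective x
  rw [rot_next, hrev] at hx
  obtain ⟨y, hy, hzy, hy_color⟩ := exists_ne_sameCycle_apply_ne hx.symm
  refine ⟨M.next y, by simpa using hy, ?_, by simpa [hrev] using hy_color.symm⟩
  rw [left_next, left_next]
  exact M.left_eq_iff.2 hzy

end ColorChange

section Touches

/-- The edge underlying `x` has an end in `A`. When `A` is one side of a separation, this property
is a two-coloring of the edges that changes only at the separating crossings. -/
def Touches (A : Set M.Crossing) (x : δ) : Prop := M.source x ∈ A ∨ M.source (M.rev x) ∈ A

theorem touches_rev (A : Set M.Crossing) (x : δ) : M.Touches A (M.rev x) = M.Touches A x := by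
  simp only [Touches, M.rev_rev, or_comm]

variable {M} {S A B : Set M.Crossing}

theorem not_touches_of_mem_right (hsep : IsSeparation M.graph S A B) {x : δ}
    (hx : M.source x ∈ B) : ¬ M.Touches A x := by
  have hxA := hsep.disjoint.notMem_of_mem_right hx
  exact not_or.2 ⟨hxA, fun hx' => hsep.not_adj _ hx' _ hx
    ⟨fun heq => hxA (heq ▸ hx'), M.rev x, rfl, by rw [M.rev_rev]⟩⟩

theorem source_mem_of_touches_ne (hsep : IsSeparation M.graph S A B) {x : δ}
    (hx : M.Touches A (M.rot x) ≠ M.Touches A x) : M.source x ∈ S := by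
  by_contra hxS
  rcases hsep.union_eq.symm.subset hxS with hxA | hxB
  · exact hx (propext (iff_of_true (.inl (by simpa)) (.inl hxA)))
  · exact hx (propext (iff_of_false (not_touches_of_mem_right hsep (by simpa))
      (not_touches_of_mem_right hsep hxB)))

end Touches

section Link

/-- The cyclic order in which one passes the positions of the link of a region. A position is a
corner `d` of the region together with one of the two edges at the crossing `M.source d` that do
not bound the corner: `(d, false)` and then `(d, true)`, in counterclockwise order. -/
def linkSucc : Perm (δ × Bool) where
  toFun
    | (d, false) => (d, true)
    | (d, true) => (M.next d, false)
  invFun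
    | (d, false) => (M.next.symm d, true)
    | (d, true) => (d, false)
  left_inv := by rintro ⟨d, _ | _⟩ <;> simp
  right_inv := by rintro ⟨d, _ | _⟩ <;> simp

/-- The corner preceding the edge of a position of the link in counterclockwise order, so that this
edge is `M.edge (M.rot (M.linkCorner w))`. At a 4-valent crossing the third corner other than `d`,
namely `M.rot.symm d`, is omitted: it lies in the same region as the corner of the next position
`(M.next d, false)`. -/
def linkCorner : δ × Bool → δ
  | (d, false) => M.rot d
  | (d, true) => M.rot (M.rot d)

variable {M}

@[simp]
theorem linkSucc_false (d : δ) : M.linkSucc (d, false) = (d, true) := rfl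

@[simp]
theorem linkSucc_true (d : δ) : M.linkSucc (d, true) = (M.next d, false) := rfl

@[simp]
theorem linkCorner_false (d : δ) : M.linkCorner (d, false) = M.rot d := rfl

@[simp]
theorem linkCorner_true (d : δ) : M.linkCorner (d, true) = M.rot (M.rot d) := rfl

@[simp]
theorem source_linkCorner (w : δ × Bool) : M.source (M.linkCorner w) = M.source w.1 := by
  obtain ⟨d, _ | _⟩ := w <;> simp

theorem isCycleOn_linkSucc [Finite δ] (R : M.Region) :
    M.linkSucc.IsCycleOn {w | M.left w.1 = R} := by
  have hmem (w) : M.left (M.linkSucc w).1 = M.left w.1 := by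
    obtain ⟨d, _ | _⟩ := w <;> simp [left_next]
  have hfalse (d : δ) (b : Bool) : M.linkSucc.SameCycle (d, false) (d, b) := by
    cases b
    exacts [.rfl, ⟨1, by simp⟩]
  refine ⟨⟨fun w hw => (hmem w).trans hw, M.linkSucc.injective.injOn, fun w hw =>
    ⟨M.linkSucc.symm w, ?_, by simp⟩⟩, ?_⟩
  · simpa using (hmem (M.linkSucc.symm w)).symm.trans (by simpa using hw)
  · rintro ⟨d, b⟩ hd ⟨d', b'⟩ hd'
    refine (hfalse d b).symm.trans (.trans ?_ (hfalse d' b'))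
    refine sameCycle_induction (p := fun z => M.linkSucc.SameCycle (d, false) (z, false))
      (fun z hz => ?_) (M.left_eq_iff.1 (Eq.trans hd (Eq.symm hd'))) .rfl
    have : (M.next z, false) = M.linkSucc (M.linkSucc (z, false)) := rfl
    rwa [this, Perm.sameCycle_apply_right, Perm.sameCycle_apply_right]

end Link

end SurfaceMap

namespace DoodleDiagram

variable {δ : Type*} [Finite δ] (D : DoodleDiagram δ)

section FourValent

theorem isCycleOn_rot_toFinset [Fintype δ] [DecidableEq D.Crossing] (x : δ) :
    D.rot.IsCycleOn ({y | D.source x = D.source y} : Finset δ) ∧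
      ({y | D.source x = D.source y} : Finset δ).card = 4 := by
  refine ⟨by simpa using D.isCycleOn_rot x, ?_⟩
  rw [← D.four_valent (D.source x), ← Set.ncard_coe_finset]
  simp [eq_comm]

@[simp]
theorem rot_rot_rot_rot (x : δ) : D.rot (D.rot (D.rot (D.rot x))) = x := by
  classical
  have := Fintype.ofFinite δ
  obtain ⟨hcycle, hcard⟩ := D.isCycleOn_rot_toFinset x
  simpa [hcard, pow_succ] using hcycle.pow_card_apply (a := x) (by simp)

@[simp]
theorem rot_rot_ne (x : δ) : D.rot (D.rot x) ≠ x := by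
  classical
  have := Fintype.ofFinite δ
  obtain ⟨hcycle, hcard⟩ := D.isCycleOn_rot_toFinset x
  simpa [pow_two, hcard] using (hcycle.pow_apply_eq (a := x) (by simp) (n := 2)).not

@[simp]
theorem rot_ne (x : δ) : D.rot x ≠ x := fun hx => D.rot_rot_ne x (by rw [hx, hx])

theorem rot_rot_rot (x : δ) : D.rot (D.rot (D.rot x)) = D.rot.symm x := by
  rw [Equiv.eq_symm_apply, rot_rot_rot_rot]

variable {D} in
theorem eq_of_source_eq {x y : δ} (hxy : D.source y = D.source x) :
    y = x ∨ y = D.rot x ∨ y = D.rot (D.rot x) ∨ y = D.rot.symm x :=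
  sameCycle_induction (p := fun y => y = x ∨ y = D.rot x ∨ y = D.rot (D.rot x) ∨ y = D.rot.symm x)
    (by rintro _ (rfl | rfl | rfl | rfl) <;> simp [rot_rot_rot])
    (D.source_eq_iff.1 hxy.symm) (.inl rfl)

theorem six_le_card_crossing (hmin : D.IsMinimal) : 6 ≤ Nat.card D.Crossing := by
  have := Fintype.ofFinite D.Crossing
  have hcrossing : Nat.card δ = 4 * Nat.card D.Crossing := by
    rw [card_eq_sum_ncard_fiber D.source]
    simp [D.four_valent, mul_comm]
  have := D.card_darts
  have := SurfaceMap.three_mul_card_region_le hmin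
  have := D.euler
  lia

end FourValent

section Coloring

variable {D}

theorem exists_coloring_of_corner_pair {d s : δ} (hne : d ≠ s)
    (hsource : D.source d = D.source s) (hleft : D.left d = D.left s) :
    ∃ h : δ → ZMod 2, (∀ x, h (D.rev x) = h x) ∧ ∀ x, h (D.rot x) ≠ h x ↔ x = d ∨ x = s := by
  classical
  simpa using SurfaceMap.exists_coloring_of_corners D.connected D.euler (C := {d, s})
    (fun f => by rw [Finset.sum_pair hne, hsource, CharTwo.add_self_eq_zero])
    (fun g => by rw [Finset.sum_pair hne, hleft, CharTwo.add_self_eq_zero])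

theorem exists_coloring_of_corner_quadruple {d s d' s' : δ} (hds : d ≠ s) (hds' : d' ≠ s')
    (hsource : D.source d = D.source s) (hsource' : D.source d' = D.source s')
    (hne : D.source d ≠ D.source d') (hd : D.left d = D.left d') (hs : D.left s = D.left s') :
    ∃ h : δ → ZMod 2, (∀ x, h (D.rev x) = h x) ∧
      ∀ x, h (D.rot x) ≠ h x ↔ x = d ∨ x = s ∨ x = d' ∨ x = s' := by
  classical
  have hsum {X : Type _} (f : X → ZMod 2) (g : δ → X) :
      ∑ x ∈ {d, s, d', s'}, f (g x) = f (g d) + f (g s) + (f (g d') + f (g s')) := by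
    rw [Finset.sum_insert, Finset.sum_insert, Finset.sum_pair hds', add_assoc] <;>
      grind
  simpa using SurfaceMap.exists_coloring_of_corners D.connected D.euler (C := {d, s, d', s'})
    (fun f => by rw [hsum, hsource, hsource', CharTwo.add_self_eq_zero, CharTwo.add_self_eq_zero,
      add_zero])
    (fun g => by rw [hsum, hd, hs, CharTwo.add_self_eq_zero])

variable (D) in
theorem left_rev_ne (x : δ) : D.left (D.rev x) ≠ D.left x := by
  classical
  have := Fintype.ofFinite δ
  intro hx
  obtain ⟨h, hrev, hrot⟩ := D.exists_coloring_of_corner_pair (d := x) (s := D.rot.symm x)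
    (by simp [Equiv.eq_symm_apply]) (by simp) (by rw [D.left_rot_symm, hx])
  -- Pushed off the crossing, the curve meets `D` only once, on `x`: recoloring this single dart
  -- removes all color changes, and then the darts cannot be counted evenly both by crossings and
  -- by edges.
  set g : δ → ZMod 2 := h + Pi.single x 1
  have hg (y) : g (D.rot y) = g y := by
    have hy := hrot y
    have hrot_y : D.rot y = x ↔ y = D.rot.symm x := D.rot.eq_symm_apply.symm
    simp only [g, Pi.add_apply, Pi.single_apply]
    rcases eq_or_ne y x with rfl | hyx
    · simpa using eq_add_one_of_ne (hy.2 (.inl rfl))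
    · by_cases hyx' : D.rot y = x
      · simpa [hyx, hyx'] using (eq_add_one_of_ne (hy.2 (.inr (hrot_y.1 hyx'))).symm).symm
      · simp [hyx, hyx', not_not.1 (hy.not.2 (by tauto))]
  have hg_sum : ∑ y, g y = 0 := sum_eq_zero_of_involution (σ := D.rot * D.rot)
    (by simp) (by simp) (by simp [hg])
  have hh_sum : ∑ y, h y = 0 := sum_eq_zero_of_involution D.rev_rev D.rev_ne hrev
  simp [g, Finset.sum_add_distrib, hh_sum] at hg_sum

end Coloring

/-- No region meets itself at a crossing: distinct corners of a region are at distinct crossings. -/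
def RegionsSimple : Prop := ∀ ⦃d s⦄, D.source d = D.source s → D.left d = D.left s → d = s

/-- Two regions meet at most once: if they meet at two different crossings, with corners `d` and `s`
at the first and `d'` and `s'` at the second, then at the first crossing they are separated by an
edge that leads to the second. -/
def RegionsMeetOnce : Prop :=
  ∀ ⦃d s d' s'⦄, D.source d = D.source s → d ≠ s → D.source d' = D.source s' →
    D.source d ≠ D.source d' → D.left d = D.left d' → D.left s = D.left s' →
    (s = D.rot d ∧ D.source (D.rev s) = D.source d') ∨
      (d = D.rot s ∧ D.source (D.rev d) = D.source d')

section RegionsSimple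

variable {D} (hmin : D.IsMinimal) (hsimple : D.RegionsSimple)

include hmin

theorem rev_eq_rot_rot_of_loop {x : δ} (hx : D.source (D.rev x) = D.source x) :
    D.rev x = D.rot (D.rot x) := by
  rcases eq_of_source_eq hx with h | h | h | h
  · exact absurd h (D.rev_ne x)
  · exact absurd h (SurfaceMap.rev_ne_rot hmin x)
  · exact h
  · refine absurd ?_ (SurfaceMap.rev_ne_rot hmin (D.rev x))
    rw [D.rev_rev, h, apply_symm_apply]

include hsimple

theorem source_rev_ne (x : δ) : D.source (D.rev x) ≠ D.source x := fun hx =>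
  have h : D.rot.symm x = D.rev x := hsimple (by simp [hx]) (D.left_rot_symm x)
  SurfaceMap.rev_ne_rot hmin (D.rev x) (by rw [D.rev_rev, ← h, apply_symm_apply])

theorem source_rev_rot_ne (x : δ) : D.source (D.rev (D.rot x)) ≠ D.source (D.rev x) := fun hx =>
  have h : D.rev (D.rot x) = D.next x :=
    hsimple (by simp [hx, D.source_next]) (by simp [D.left_next])
  SurfaceMap.next_next_ne_self hmin x (by rw [← h, D.next_rev_rot])

end RegionsSimple

section Prime

variable {D}

theorem regionsSimple_of_preconnected (hmin : D.IsMinimal)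
    (hconn : ∀ u, (D.graph.induce {u}ᶜ).Preconnected) : D.RegionsSimple := by
  intro d s hsource hleft
  by_contra hne
  obtain ⟨h, hrev, hrot⟩ := exists_coloring_of_corner_pair hne hsource hleft
  have hoff {x y : δ} (hx : D.source x ≠ D.source d) (hy : D.source y ≠ D.source d) :
      h x = h y := by
    refine D.color_eq_of_preconnected (hconn (D.source d)) hrev (fun z hz => ?_) hx hy
    by_contra hz'
    rcases (hrot z).1 hz' with rfl | rfl
    exacts [hz rfl, hz hsource.symm]
  have hopp {x : δ} (hx : D.source x = D.source d) : h (D.rot (D.rot x)) = h x := by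
    by_cases hloop : D.source (D.rev x) = D.source x
    · rw [← rev_eq_rot_rot_of_loop hmin hloop, hrev]
    · rw [← hrev, ← hrev x]
      refine hoff (fun hy => hloop ?_) (hx ▸ hloop)
      have := rev_eq_rot_rot_of_loop hmin (x := D.rot (D.rot x)) (by simp [hx, hy])
      rw [rot_rot_rot_rot] at this
      rw [← this, D.rev_rev]
      simp [this]
  have hd : h (D.rot d) ≠ h d := (hrot d).2 (.inl rfl)
  have hs₁ : D.rot d = s :=
    ((hrot _).1 (by rw [hopp rfl]; exact hd.symm)).resolve_left (D.rot_ne d)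
  have hs₂ : D.rot (D.rot d) = s := by
    refine ((hrot _).1 ?_).resolve_left (D.rot_rot_ne d)
    rw [hopp rfl, hopp (by simp)]
    exact hd
  exact D.rot_ne (D.rot d) (hs₂.trans hs₁.symm)

theorem eq_rot_and_source_rev_eq_of_color_change {X : Type*} {h : δ → X} {d s : δ} {v : D.Crossing}
    (hsource : D.source d = D.source s) (hne : d ≠ s)
    (hto : ∀ {x y}, D.source x = D.source d → D.source y = D.source d → h x ≠ h y →
      D.source (D.rev x) = v ∨ D.source (D.rev y) = v)
    (hconsec : ∀ x, D.source (D.rev x) = v → D.source (D.rev (D.rot x)) ≠ v)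
    (hrot : ∀ x, D.source x = D.source d → (h (D.rot x) ≠ h x ↔ x = d ∨ x = s)) :
    (s = D.rot d ∧ D.source (D.rev s) = v) ∨ (d = D.rot s ∧ D.source (D.rev d) = v) := by
  have hlead {x : δ} (hx : D.source x = D.source d) (hx_mem : x = d ∨ x = s)
      (hrot_x : ¬(D.rot x = d ∨ D.rot x = s)) : D.source (D.rev x) = v := by
    have hx_rot : h (D.rot x) ≠ h x := (hrot x hx).2 hx_mem
    have hx_rot_rot : h (D.rot (D.rot x)) = h (D.rot x) :=
      not_not.1 ((hrot _ (by simpa)).not.2 hrot_x)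
    by_contra hx_lead
    exact hconsec _ ((hto (by simpa) hx hx_rot).resolve_right hx_lead)
      ((hto (by simpa) hx (hx_rot_rot ▸ hx_rot)).resolve_right hx_lead)
  rcases eq_of_source_eq hsource.symm with rfl | rfl | rfl | rfl
  · exact absurd rfl hne
  · exact .inl ⟨rfl, hlead hsource.symm (.inr rfl) (by simp)⟩
  · have hd_lead := hlead rfl (.inl rfl) (by simp [(D.rot_ne d).symm])
    have hs_lead := hlead hsource.symm (.inr rfl)
      (by simp [rot_rot_rot, Equiv.symm_apply_eq, Equiv.eq_symm_apply, (D.rot_ne d).symm])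
    have hcolor : h (D.rot d) ≠ h (D.rot (D.rot (D.rot d))) := by
      rw [← not_not.1 ((hrot (D.rot d) (by simp)).not.2 (by simp [(D.rot_ne d).symm]))]
      exact ((hrot _ hsource.symm).2 (.inr rfl)).symm
    exact ((hto (by simp) (by simp) hcolor).elim (hconsec _ hd_lead) (hconsec _ hs_lead)).elim
  · exact .inr ⟨by simp, hlead rfl (.inl rfl)
      (by simp [Equiv.eq_symm_apply])⟩

theorem regionsMeetOnce_of_preconnected (hmin : D.IsMinimal) (hsimple : D.RegionsSimple)
    (hconn : ∀ u v, (D.graph.induce {u, v}ᶜ).Preconnected) : D.RegionsMeetOnce := by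
  intro d s d' s' hds hds_ne hds' hne hd hs
  have hds_ne' : d' ≠ s' := by
    rintro rfl
    exact hds_ne (hsimple hds (hd.trans hs.symm))
  obtain ⟨h, hrev, hrot⟩ := exists_coloring_of_corner_quadruple hds_ne hds_ne' hds hds' hne hd hs
  have hoff {x y : δ} (hx : D.source x ∉ ({D.source d, D.source d'} : Set _))
      (hy : D.source y ∉ ({D.source d, D.source d'} : Set _)) : h x = h y := by
    refine D.color_eq_of_preconnected (hconn (D.source d) (D.source d')) hrev (fun z hz => ?_) hx hy
    by_contra hz'
    rcases (hrot z).1 hz' with rfl | rfl | rfl | rfl <;> simp_all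
  have hto {x y : δ} (hx : D.source x = D.source d) (hy : D.source y = D.source d)
      (hxy : h x ≠ h y) : D.source (D.rev x) = D.source d' ∨ D.source (D.rev y) = D.source d' := by
    by_contra! hcon
    refine hxy ?_
    rw [← hrev x, ← hrev y]
    refine hoff ?_ ?_
    · simpa [← hx, hcon.1] using source_rev_ne hmin hsimple x
    · simpa [← hy, hcon.2] using source_rev_ne hmin hsimple y
  refine eq_rot_and_source_rev_eq_of_color_change hds hds_ne hto
    (fun x hx hx' => source_rev_rot_ne hmin hsimple x (hx'.trans hx.symm)) fun x hx => ?_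
  rw [hrot]
  have hx₁ : x ≠ d' := by rintro rfl; exact hne hx.symm
  have hx₂ : x ≠ s' := by rintro rfl; exact hne (hds' ▸ hx.symm)
  tauto

end Prime

section LinkWalk

variable {D}

theorem regionsSimple_of_isCircle_boundary (hcircle : ∀ R, IsCircle (D.boundary R)) :
    D.RegionsSimple := by
  intro d s hsource hleft
  by_contra hne
  obtain ⟨h, hrev, hrot⟩ := exists_coloring_of_corner_pair hne hsource hleft
  have hregion {x y : δ} (hx : D.left x ≠ D.left d) (hxy : D.left x = D.left y) : h x = h y := by
    refine (sameCycle_induction (p := fun y => D.left y ≠ D.left d ∧ h x = h y) ?_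
      (D.left_eq_iff.1 hxy) ⟨hx, rfl⟩).2
    rintro z ⟨hz, hxz⟩
    have hz_next : ¬ (D.next z = d ∨ D.next z = s) := by
      rw [← D.left_next] at hz
      rintro (hd | hs)
      exacts [hz (congrArg D.left hd), hz ((congrArg D.left hs).trans hleft.symm)]
    refine ⟨by rwa [D.left_next], ?_⟩
    rw [hxz, ← not_not.1 (mt (hrot (D.next z)).1 hz_next), D.rot_next, hrev]
  have hout (R : D.Region) : D.left R.out = R := Quotient.out_eq R
  have hlink {e S T} (hST : (D.boundary (D.left d)).IsLink e S T) : h S.out = h T.out := by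
    obtain ⟨⟨x, -, rfl, rfl⟩, -⟩ := id hST
    rw [← hregion hST.left_mem.1 (hout _).symm, ← hrev x, ← hregion hST.right_mem.1 (hout _).symm]
  have hd : D.left (D.rev d) ≠ D.left d := D.left_rev_ne d
  have hd_rot : D.left (D.rot d) ≠ D.left d := by
    rw [← D.left_rev_rot d]
    exact (D.left_rev_ne (D.rot d)).symm
  refine (hrot d).2 (.inl rfl) ?_
  rw [hregion hd_rot (hout _).symm, ← hrev d, hregion hd (hout _).symm]
  exact (hcircle (D.left d)).apply_eq_of_isLink (f := fun R => h R.out) (fun _ _ _ => hlink)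
    ⟨hd_rot, D.source d, ⟨d, rfl, rfl⟩, D.rot d, D.source_rot d, rfl⟩
    ⟨hd, D.source d, ⟨d, rfl, rfl⟩, D.rot.symm d, D.source_rot_symm d, D.left_rot_symm d⟩

theorem left_linkCorner_linkSucc (w : δ × Bool) :
    D.left (D.linkCorner (D.linkSucc w)) = D.left (D.rot (D.linkCorner w)) := by
  obtain ⟨d, _ | _⟩ := w
  · rfl
  · simp [rot_rot_rot, D.left_rot_symm]

theorem linkCorner_ne (w : δ × Bool) : D.linkCorner w ≠ w.1 := by
  obtain ⟨d, _ | _⟩ := w <;> simp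

theorem rot_linkCorner_ne (w : δ × Bool) : D.rot (D.linkCorner w) ≠ w.1 := by
  obtain ⟨d, _ | _⟩ := w <;> simp [rot_rot_rot, Equiv.symm_apply_eq, (D.rot_ne _).symm]

theorem exists_left_linkCorner_eq {d s : δ} (hsource : D.source s = D.source d) (hne : s ≠ d) :
    ∃ w, D.left w.1 = D.left d ∧ D.left (D.linkCorner w) = D.left s ∧
      (s = D.rot d ∧ w = (d, false) ∨ w = (d, true) ∨ d = D.rot s ∧ w = (D.next d, false)) := by
  rcases eq_of_source_eq hsource with rfl | rfl | rfl | rfl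
  · exact absurd rfl hne
  · exact ⟨(d, false), rfl, rfl, .inl ⟨rfl, rfl⟩⟩
  · exact ⟨(d, true), rfl, rfl, .inr (.inl rfl)⟩
  · refine ⟨(D.next d, false), D.left_next d, ?_, .inr (.inr ⟨by simp, rfl⟩)⟩
    rw [D.linkCorner_false, D.rot_next, D.left_rot_symm]

variable (hsimple : D.RegionsSimple)
include hsimple

theorem eq_of_linkCorner_eq {w w' : δ × Bool} (hleft : D.left w.1 = D.left w'.1)
    (hcorner : D.linkCorner w = D.linkCorner w') : w = w' := by
  have hsource := congrArg D.source hcorner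
  simp only [SurfaceMap.source_linkCorner] at hsource
  obtain ⟨d, b⟩ := w
  obtain ⟨d', b'⟩ := w'
  obtain rfl : d = d' := hsimple hsource hleft
  cases b <;> cases b' <;> simp [(D.rot_ne _).symm] at hcorner ⊢

theorem eq_of_left_linkCorner_eq_of_edge_eq {w w' : δ × Bool} (hleft : D.left w.1 = D.left w'.1)
    (hregion : D.left (D.linkCorner w) = D.left (D.linkCorner w'))
    (hedge : D.edge (D.rot (D.linkCorner w)) = D.edge (D.rot (D.linkCorner w'))) : w = w' := by
  refine eq_of_linkCorner_eq hsimple hleft (D.rot.injective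
    (((D.edge_eq_iff _ _).1 hedge).resolve_right fun h => ?_).symm)
  rw [← D.left_rev_rot, ← D.left_rev_rot (D.linkCorner w'), h, D.rev_rev] at hregion
  exact D.left_rev_ne _ hregion

theorem isLink_boundary (w : δ × Bool) :
    (D.boundary (D.left w.1)).IsLink (D.edge (D.rot (D.linkCorner w))) (D.left (D.linkCorner w))
      (D.left (D.linkCorner (D.linkSucc w))) := by
  refine ⟨⟨D.rev (D.rot (D.linkCorner w)), D.edge_rev _, by simp, ?_⟩, ?_, D.source w.1,
    ⟨_, rfl, rfl⟩, D.rot (D.linkCorner w), by simp, rfl⟩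
  · rw [D.rev_rev, left_linkCorner_linkSucc]
  · rintro ⟨S, d, hd, hR, -⟩
    rcases (D.edge_eq_iff _ _).1 hd with rfl | h
    · exact rot_linkCorner_ne w (hsimple (by simp) hR)
    · refine linkCorner_ne w (hsimple (D.source_linkCorner w) ?_)
      rw [← D.left_rev_rot, h, D.rev_rev, hR]

theorem next_eq_of_left_linkCorner_eq (hmeet : D.RegionsMeetOnce) {w w' : δ × Bool}
    (hleft : D.left w.1 = D.left w'.1)
    (hregion : D.left (D.linkCorner w) = D.left (D.linkCorner w'))
    (hne : D.source w.1 ≠ D.source w'.1) : D.next w'.1 = w.1 := by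
  obtain ⟨hrot, hsource⟩ := (hmeet (by simp) (linkCorner_ne w).symm (by simp) hne hleft
    hregion).resolve_right fun h => rot_linkCorner_ne w h.1.symm
  rw [hrot] at hsource
  rw [← hsimple hsource ((D.left_rev_rot _).trans hleft), D.next_rev_rot]

variable (hmin : D.IsMinimal)
include hmin

theorem edge_rot_linkCorner_linkSucc_ne (w : δ × Bool) :
    D.edge (D.rot (D.linkCorner (D.linkSucc w))) ≠ D.edge (D.rot (D.linkCorner w)) := by
  intro h
  obtain ⟨d, _ | _⟩ := w
  · rcases (D.edge_eq_iff _ _).1 h with h | h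
    · exact D.rot_ne _ h.symm
    · exact source_rev_ne hmin hsimple (D.rot.symm d)
        (by simpa [rot_rot_rot] using (congrArg D.source h).symm)
  · rcases (D.edge_eq_iff _ _).1 h with h | h
    · exact source_rev_ne hmin hsimple d (by simpa using (congrArg D.source h).symm)
    · refine source_rev_rot_ne hmin hsimple (D.rot.symm d) ?_
      simpa [D.rev_rev, rot_rot_rot] using (congrArg (D.source ∘ D.rev) h).symm

theorem isCircle_boundary_iff (R : D.Region) :
    IsCircle (D.boundary R) ↔ {w | D.left w.1 = R}.InjOn (D.left ∘ D.linkCorner) := by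
  have hlink (w : δ × Bool) (hw : D.left w.1 = R) :
      (D.boundary R).IsLink (D.edge (D.rot (D.linkCorner w))) (D.left (D.linkCorner w))
        (D.left (D.linkCorner (D.linkSucc w))) := hw ▸ isLink_boundary hsimple w
  refine ⟨fun hcircle => hcircle.injOn_of_walk (D.isCycleOn_linkSucc R) hlink
    (fun w _ => edge_rot_linkCorner_linkSucc_ne hsimple hmin w) fun w hw w' hw' =>
      eq_of_left_linkCorner_eq_of_edge_eq hsimple (Eq.trans hw (Eq.symm hw')),
    fun hinj => isCircle_of_injOn (D.isCycleOn_linkSucc R) ?_ hlink ?_ hinj ?_ ?_⟩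
  · obtain ⟨d, rfl⟩ := D.left_surjective R
    exact ⟨(d, false), rfl⟩
  · rintro ⟨d, _ | _⟩ - <;> simp [SurfaceMap.next_ne_self hmin]
  · rintro _ ⟨hne, c, ⟨d, rfl, rfl⟩, s, hs, rfl⟩
    obtain ⟨w, hw, hws, -⟩ := exists_left_linkCorner_eq hs (by rintro rfl; exact hne rfl)
    exact ⟨w, hw, hws⟩
  · rintro _ ⟨S, T, -, hinc, c, ⟨d, rfl, rfl⟩, y, hy, rfl⟩
    rcases eq_of_source_eq hy with rfl | rfl | rfl | rfl
    · exact absurd ⟨_, y, rfl, rfl, rfl⟩ hinc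
    · exact absurd ⟨_, D.rev (D.rot d), D.edge_rev _, D.left_rev_rot d, rfl⟩ hinc
    · exact ⟨(d, false), rfl, rfl⟩
    · exact ⟨(d, true), rfl, by simp [rot_rot_rot]⟩

theorem regionsMeetOnce_iff :
    D.RegionsMeetOnce ↔ ∀ R, {w | D.left w.1 = R}.InjOn (D.left ∘ D.linkCorner) := by
  refine ⟨fun hmeet R w hw w' hw' hww' => ?_, fun hinj d s d' s' hds hne hds' hdd' hd hs => ?_⟩
  · have hleft : D.left w.1 = D.left w'.1 := Eq.trans hw (Eq.symm hw')
    by_cases hsource : D.source w.1 = D.source w'.1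
    · exact eq_of_linkCorner_eq hsimple hleft (hsimple (by simpa using hsource) hww')
    · refine absurd ?_ (SurfaceMap.next_next_ne_self hmin w.1)
      rw [next_eq_of_left_linkCorner_eq hsimple hmeet hleft.symm hww'.symm (Ne.symm hsource),
        next_eq_of_left_linkCorner_eq hsimple hmeet hleft hww' hsource]
  · have hne' : s' ≠ d' := by
      rintro rfl
      exact hne (hsimple hds (hd.trans hs.symm))
    obtain ⟨w, hw, hws, hcase⟩ := exists_left_linkCorner_eq hds.symm hne.symm
    obtain ⟨w', hw', hws', hcase'⟩ := exists_left_linkCorner_eq hds'.symm hne'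
    obtain rfl : w = w' :=
      hinj (D.left d) hw (hw'.trans hd.symm) (hws.trans (hs.trans hws'.symm))
    have hdd'_ne : d ≠ d' := ne_of_apply_ne _ hdd'
    rcases hcase with ⟨rfl, rfl⟩ | rfl | ⟨hds_rot, rfl⟩ <;>
      simp only [Prod.mk.injEq, hdd'_ne, EmbeddingLike.apply_eq_iff_eq, and_true, and_false,
        false_or, or_false, reduceCtorEq] at hcase'
    · exact .inl ⟨rfl, by rw [hcase'.2, D.rot_next, D.rev_rev]⟩
    · exact .inr ⟨hds_rot, by rw [← D.source_next, hcase'.2]⟩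

end LinkWalk

section ThreeConnected

variable {D} (hsimple : D.RegionsSimple)
include hsimple

section ColorChange

variable {X : Type*} {h : δ → X} (hrev : ∀ x, h (D.rev x) = h x)
include hrev

theorem exists_source_ne_color_ne {x : δ} (hx : h (D.rot x) ≠ h x) :
    ∃ y, D.source x ≠ D.source y ∧ D.left x = D.left y ∧ h (D.rot y) ≠ h y := by
  obtain ⟨y, hne, hleft, hy⟩ := SurfaceMap.exists_ne_left_eq_color_ne hrev hx
  exact ⟨y, fun hsource => hne (hsimple hsource hleft).symm, hleft, hy⟩

theorem eq_rot_of_color_ne (hmeet : D.RegionsMeetOnce) {u v : D.Crossing}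
    (huv : ∀ x, h (D.rot x) ≠ h x → D.source x = u ∨ D.source x = v) {d s : δ}
    (hd : D.source d = u) (hs : D.source s = u) (hne : d ≠ s) (hd_color : h (D.rot d) ≠ h d)
    (hs_color : h (D.rot s) ≠ h s) :
    (s = D.rot d ∧ D.source (D.rev s) = v) ∨ (d = D.rot s ∧ D.source (D.rev d) = v) := by
  subst hd
  obtain ⟨d', hdd', hd_left, hd'⟩ := exists_source_ne_color_ne hsimple hrev hd_color
  obtain ⟨s', hss', hs_left, hs'⟩ := exists_source_ne_color_ne hsimple hrev hs_color
  obtain rfl := (huv d' hd').resolve_left hdd'.symm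
  have hs'_source := (huv s' hs').resolve_left fun h => hss' (hs.trans h.symm)
  exact hmeet hs.symm hne hs'_source.symm hdd' hd_left hs_left

theorem color_ne_rot (hmeet : D.RegionsMeetOnce) {u v : D.Crossing}
    (huv : ∀ x, h (D.rot x) ≠ h x → D.source x = u ∨ D.source x = v) {d : δ} (hd : D.source d = u)
    (hd_color : h (D.rot d) ≠ h d) (hd_rot_color : h (D.rot (D.rot d)) ≠ h (D.rot d)) {x : δ}
    (hx : D.source x = u) (hxd : x ≠ D.rot d) : h x ≠ h (D.rot d) := by
  have hopp : h (D.rot (D.rot (D.rot d))) = h (D.rot (D.rot d)) := by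
    by_contra hcolor
    rcases eq_rot_of_color_ne hsimple hrev hmeet huv hd (by simpa) (D.rot_rot_ne d).symm hd_color
      hcolor with ⟨h, -⟩ | ⟨h, -⟩
    · exact D.rot_ne _ h
    · rw [rot_rot_rot, Equiv.eq_symm_apply] at h
      exact D.rot_ne d h
  rcases eq_of_source_eq (hx.trans hd.symm) with rfl | rfl | rfl | rfl
  · exact hd_color.symm
  · exact absurd rfl hxd
  · exact hd_rot_color
  · rwa [← rot_rot_rot, hopp]

theorem exists_dart_color_ne (hmeet : D.RegionsMeetOnce) {u v : D.Crossing}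
    (huv : ∀ x, h (D.rot x) ≠ h x → D.source x = u ∨ D.source x = v) {d : δ}
    (hd : D.source d = u) (hd_color : h (D.rot d) ≠ h d) :
    ∃ t, D.source t = u ∧ D.source (D.rev t) = v ∧ ∀ x, D.source x = u → x ≠ t → h x ≠ h t := by
  obtain ⟨s, hne, hs, hs_color⟩ := SurfaceMap.exists_ne_source_eq_color_ne hd_color
  replace hs := hs.symm.trans hd
  rcases eq_rot_of_color_ne hsimple hrev hmeet huv hd hs hne.symm hd_color hs_color with
    ⟨rfl, hv⟩ | ⟨rfl, hv⟩
  · exact ⟨_, hs, hv, fun _ => color_ne_rot hsimple hrev hmeet huv hd hd_color hs_color⟩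
  · exact ⟨_, hd, hv, fun _ => color_ne_rot hsimple hrev hmeet huv hs hs_color hd_color⟩

theorem exists_pair_color_ne {S : Finset D.Crossing} (hS : S.card < 3)
    (hS_color : ∀ x, h (D.rot x) ≠ h x → D.source x ∈ S) {a b : δ} (hab : h a ≠ h b) :
    ∃ x y, h (D.rot x) ≠ h x ∧ h (D.rot y) ≠ h y ∧
      ∀ u, u ∈ S ↔ u = D.source x ∨ u = D.source y := by
  classical
  obtain ⟨x, hx⟩ : ∃ x, h (D.rot x) ≠ h x := by
    by_contra! hconst
    exact hab (D.color_eq_of_connected D.connected hrev hconst a b)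
  obtain ⟨y, hxy, -, hy⟩ := exists_source_ne_color_ne hsimple hrev hx
  have hS_eq : {D.source x, D.source y} = S := by
    refine Finset.eq_of_subset_of_card_le ?_ (by rw [Finset.card_pair hxy]; lia)
    simp [Finset.insert_subset_iff, hS_color x hx, hS_color y hy]
  exact ⟨x, y, hx, hy, fun u => by simp [← hS_eq]⟩

end ColorChange

theorem exists_dart_forall_source_rev_mem (hmeet : D.RegionsMeetOnce) {u v : D.Crossing}
    {A B : Set D.Crossing} (hsep : IsSeparation D.graph {u, v} A B) {d : δ} (hd : D.source d = u)
    (hd_touches : D.Touches A (D.rot d) ≠ D.Touches A d) :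
    ∃ t, ∀ x, D.source x = u → x ≠ t → D.source (D.rev x) ∈ A := by
  obtain ⟨t, ht, ht_rev, ht_ne⟩ := exists_dart_color_ne hsimple (D.touches_rev A) hmeet
    (fun x hx => SurfaceMap.source_mem_of_touches_ne hsep hx) hd hd_touches
  have hnotMem {w : D.Crossing} (hw : w = u ∨ w = v) : w ∉ A :=
    fun hwA => hsep.notMem_of_mem_left hwA hw
  have ht_touches : ¬ D.Touches A t := not_or.2 ⟨hnotMem (.inl ht), hnotMem (.inr ht_rev)⟩
  refine ⟨t, fun x hx hxt => ?_⟩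
  have hx_touches : D.Touches A x :=
    not_not.1 fun hx' => ht_ne x hx hxt (propext (iff_of_false hx' ht_touches))
  exact hx_touches.resolve_left (hnotMem (.inl hx))

theorem nonempty_and_exists_dart_of_isSeparation (hmeet : D.RegionsMeetOnce)
    {S : Finset D.Crossing} (hS : S.card < 3) {A B : Set D.Crossing}
    (hsep : IsSeparation D.graph S A B) :
    S.Nonempty ∧ ∀ u ∈ S, ∃ t, ∀ x, D.source x = u → x ≠ t → D.source (D.rev x) ∈ A := by
  obtain ⟨a, ha⟩ : ∃ a, D.source a ∈ A := D.source_surjective.exists.1 hsep.left_nonempty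
  obtain ⟨b, hb⟩ : ∃ b, D.source b ∈ B := D.source_surjective.exists.1 hsep.right_nonempty
  have hab : D.Touches A a ≠ D.Touches A b := fun h =>
    SurfaceMap.not_touches_of_mem_right hsep hb (h ▸ .inl ha)
  obtain ⟨x, y, hx, hy, hmem⟩ := exists_pair_color_ne hsimple (D.touches_rev A) hS
    (fun x hx => SurfaceMap.source_mem_of_touches_ne hsep hx) hab
  have hS_eq : (S : Set D.Crossing) = {D.source x, D.source y} := Set.ext hmem
  refine ⟨⟨D.source x, (hmem _).2 (.inl rfl)⟩, fun u hu => ?_⟩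
  rcases (hmem u).1 hu with rfl | rfl
  · exact exists_dart_forall_source_rev_mem hsimple hmeet (hS_eq ▸ hsep) rfl hx
  · rw [Set.pair_comm] at hS_eq
    exact exists_dart_forall_source_rev_mem hsimple hmeet (hS_eq ▸ hsep) rfl hy

theorem preconnected_induce_compl (hmeet : D.RegionsMeetOnce) {S : Finset D.Crossing}
    (hS : S.card < 3) : (D.graph.induce (S : Set D.Crossing)ᶜ).Preconnected := by
  by_contra hnot
  obtain ⟨A, B, hsep⟩ := exists_isSeparation hnot
  obtain ⟨⟨u, hu⟩, hA⟩ := nonempty_and_exists_dart_of_isSeparation hsimple hmeet hS hsep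
  obtain ⟨a, ha⟩ := hA u hu
  obtain ⟨b, hb⟩ := (nonempty_and_exists_dart_of_isSeparation hsimple hmeet hS hsep.symm).2 u hu
  have hcard : ({a, b} : Set δ).ncard < {x | D.source x = u}.ncard := by
    rw [D.four_valent]
    exact (ncard_pair_le a b).trans_lt (by lia)
  obtain ⟨x, hx, hxab⟩ := Set.exists_mem_notMem_of_ncard_lt_ncard hcard
  obtain ⟨hxa, hxb⟩ := not_or.1 hxab
  exact hsep.disjoint.notMem_of_mem_left (ha x hx hxa) (hb x hx hxb)

end ThreeConnected

variable {D}

theorem isPrime_iff (hmin : D.IsMinimal) : D.IsPrime ↔ D.RegionsSimple ∧ D.RegionsMeetOnce := by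
  classical
  have hcard := D.six_le_card_crossing hmin
  constructor
  · rintro ⟨-, hconn⟩
    have hpair (u v : D.Crossing) : (D.graph.induce {u, v}ᶜ).Preconnected := by
      rw [← Finset.coe_pair]
      exact (hconn {u, v} (Finset.card_le_two.trans_lt (by lia))).preconnected
    have hsimple : D.RegionsSimple :=
      regionsSimple_of_preconnected hmin fun u => Set.pair_eq_singleton u ▸ hpair u u
    exact ⟨hsimple, regionsMeetOnce_of_preconnected hmin hsimple hpair⟩
  · rintro ⟨hsimple, hmeet⟩
    refine ⟨by lia, fun S hS => ?_⟩
    obtain ⟨u, hu⟩ : ∃ u, u ∉ S := by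
      by_contra! hall
      have := Set.ncard_univ D.Crossing
      rw [← Set.eq_univ_of_forall hall, Set.ncard_coe_finset] at this
      lia
    exact { preconnected := preconnected_induce_compl hsimple hmeet hS, nonempty := ⟨⟨u, hu⟩⟩ }

end DoodleDiagram

theorem lemma7p8_general {δ : Type*} [Finite δ] (D : DoodleDiagram δ) (hmin : D.IsMinimal) :
    D.IsPrime ↔ ∀ R : D.Region, IsCircle (D.boundary R) := by
  have hcircle (hsimple : D.RegionsSimple) :
      D.RegionsMeetOnce ↔ ∀ R, IsCircle (D.boundary R) :=
    (DoodleDiagram.regionsMeetOnce_iff hsimple hmin).trans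
      (forall_congr' fun R => (DoodleDiagram.isCircle_boundary_iff hsimple hmin R).symm)
  rw [DoodleDiagram.isPrime_iff hmin]
  constructor
  · rintro ⟨hsimple, hmeet⟩
    exact (hcircle hsimple).1 hmeet
  · intro hcircles
    have hsimple := DoodleDiagram.regionsSimple_of_isCircle_boundary hcircles
    exact ⟨hsimple, (hcircle hsimple).2 hcircles⟩

theorem lemma7p8 {δ : Type*} [Finite δ] (D : DoodleDiagram δ) (hmin : D.IsMinimal)
    (hconn : IsKConnected 2 D.graph) :
    D.IsPrime ↔ ∀ R : D.Region, IsCircle (D.boundary R) :=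
  lemma7p8_general D hmin
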